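/- Let $G$ be a finitely generated virtually free group and $\varphi\in\mathrm{End}(G)$. Then there is a computable constant $k$ that bounds the size of the straight part of every finite orbit of $\varphi$. Here the orbit of $x\in G$ is $\mathrm{Orb}_\varphi(x)=\{\varphi^j(x) : j\ge 0\}$, a point $y$ is periodic if $\varphi^j(y)=y$ for some $j\ge 1$, and the straight part of a finite orbit is the set of its points that are not periodic. The pair $(G,\varphi)$ is given to an algorithm by the following finite data: a finite alphabet $A$ and letters $b_1,\dots,b_m$, words $u_{ia},v_{ij}$ over $A^{\pm1}$ and indices $r_{ij}\in\{1,\dots,m\}$ such that $G$ has the presentation $$\langle A,b_1,\dots,b_m \mid b_ia=u_{ia}b_i,\; b_ib_j=v_{ij}b_{r_{ij}}\ (a\in A,\ 1\le i,j\le m)\rangle,$$ where $A$ freely generates a normal subgroup $F$ of $G$ and $G=Fb_1\cup\dots\cup Fb_m$ is a disjoint union; and, for each generator, a word over $(A\cup\{b_1,\dots,b_m\})^{\pm1}$ representing its image under $\varphi$. Computability of $k$ means: every pair $(G,\varphi)$ as above has a description by such data, and there is one computable function $K$ from (codes of) such data to $\mathbb{N}$ such that, whenever data $d$ describe $(G,\varphi)$,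 the straight part of every finite orbit of $\varphi$ has at most $K(d)$ elements. -/

import Mathlib

/-- The orbit `{x, φ x, φ² x, …}` of `x` under iteration of the endomorphism `φ`. -/
def endOrbit {G : Type*} [Group G] (φ : G →* G) (x : G) : Set G :=
  Set.range fun k : ℕ => φ^[k] x

/-- The straight part of the orbit of `x`: the points of the orbit which are not periodic
(`y` is periodic if `φ^m y = y` for some `m ≥ 1`). -/
def straightPart {G : Type*} [Group G] (φ : G →* G) (x : G) : Set G :=
  endOrbit φ x \ Function.periodicPts φ

/-- `G` is virtually free: it has a free subgroup of finite index. -/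
def IsVirtuallyFree (G : Type*) [Group G] : Prop :=
  ∃ H : Subgroup G, H.FiniteIndex ∧ IsFreeGroup H

/-- The finite data by which a finitely generated virtually free group together with an
endomorphism is given as the input of an algorithm. The generators are the letters
`a_x` (`x : Fin n`, written `Sum.inl x`) and `b_i` (`i : Fin m`, written `Sum.inr i`); a word is a
list of letters with exponents (`true` for `+1`, `false` for `-1`). -/
structure VFData where
  /-- the number of letters `a_x`, i.e. the rank of the free normal subgroup -/
  n : ℕ
  /-- the number of letters `b_i`, i.e. the number of cosets -/
  m : ℕ
  /-- the words `u_{i,x}` in the letters `a` of the relations `b_i a_x = u_{i,x} b_i` -/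
  u : Fin m → Fin n → List (Fin n × Bool)
  /-- the words `v_{i,j}` in the letters `a` of the relations `b_i b_j = v_{i,j} b_{r(i,j)}` -/
  v : Fin m → Fin m → List (Fin n × Bool)
  /-- the indices `r(i,j)` of the relations `b_i b_j = v_{i,j} b_{r(i,j)}` -/
  r : Fin m → Fin m → Fin m
  /-- for each generator a word, in all the generators, for its image under the endomorphism -/
  img : Fin n ⊕ Fin m → List ((Fin n ⊕ Fin m) × Bool)

namespace VFData

/-- The relators of the presentation given by the data:
`b_i a_x (u_{i,x} b_i)⁻¹` and `b_i b_j (v_{i,j} b_{r(i,j)})⁻¹`. -/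
def rels (d : VFData) : Set (FreeGroup (Fin d.n ⊕ Fin d.m)) :=
  (Set.range fun p : Fin d.m × Fin d.n =>
    FreeGroup.of (Sum.inr p.1) * FreeGroup.of (Sum.inl p.2) *
      (FreeGroup.map Sum.inl (FreeGroup.mk (d.u p.1 p.2)) * FreeGroup.of (Sum.inr p.1))⁻¹) ∪
  (Set.range fun p : Fin d.m × Fin d.m =>
    FreeGroup.of (Sum.inr p.1) * FreeGroup.of (Sum.inr p.2) *
      (FreeGroup.map Sum.inl (FreeGroup.mk (d.v p.1 p.2)) *
        FreeGroup.of (Sum.inr (d.r p.1 p.2)))⁻¹)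

/-- The subgroup generated by the images of the letters `a_x`. -/
def freePart (d : VFData) {G : Type*} [Group G] (gen : Fin d.n ⊕ Fin d.m → G) : Subgroup G :=
  (FreeGroup.lift fun x => gen (Sum.inl x)).range

/-- The data `d` describe the group `G` and its endomorphism `φ`, the generators of the data
being interpreted in `G` by `gen`. -/
structure DescribesVia (d : VFData) {G : Type*} [Group G] (φ : G →* G)
    (gen : Fin d.n ⊕ Fin d.m → G) : Prop where
  /-- the generators generate `G` -/
  surjective : Function.Surjective (FreeGroup.lift gen)
  /-- the relators of `d` are defining relators of `G` -/
  ker_eq : (FreeGroup.lift gen).ker = Subgroup.normalClosure d.rels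
  /-- the elements `a_x` freely generate the subgroup `F` which they generate -/
  free : Function.Injective (FreeGroup.lift fun x => gen (Sum.inl x))
  /-- `F` is normal in `G` -/
  normal : (d.freePart gen).Normal
  /-- `G` is the disjoint union of the cosets `F b_i` -/
  cosets : ∀ g : G, ∃! i : Fin d.m, ∃ f ∈ d.freePart gen, g = f * gen (Sum.inr i)
  /-- `φ` maps each generator to the element represented by the given word -/
  map_gen : ∀ s, φ (gen s) = FreeGroup.lift gen (FreeGroup.mk (d.img s))

/-- The data `d` describe the group `G` and its endomorphism `φ`. -/
def Describes (d : VFData) {G : Type*} [Group G] (φ : G →* G) : Prop :=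
  ∃ gen : Fin d.n ⊕ Fin d.m → G, d.DescribesVia φ gen

/-- The type of the codes of data: the numbers `n` and `m`, the tables of the `u_{i,x}`, of the
`v_{i,j}` and of the `r(i,j)`, and the lists of the images of the `a_x` and of the `b_i`. -/
abbrev Code : Type :=
  ℕ × ℕ × List (List (List (ℕ × Bool))) × List (List (List (ℕ × Bool))) × List (List ℕ) ×
    List (List ((ℕ ⊕ ℕ) × Bool)) × List (List ((ℕ ⊕ ℕ) × Bool))

/-- A word in the letters `a_x`, with the letters replaced by their numbers. -/
def wordCode {n : ℕ} (w : List (Fin n × Bool)) : List (ℕ × Bool) :=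
  w.map fun p => (p.1.val, p.2)

/-- A word in all the letters, with the letters replaced by their numbers. -/
def genWordCode {n m : ℕ} (w : List ((Fin n ⊕ Fin m) × Bool)) : List ((ℕ ⊕ ℕ) × Bool) :=
  w.map fun p => (Sum.map Fin.val Fin.val p.1, p.2)

/-- The code of the data: all entries are written out as lists of numbers. -/
def code (d : VFData) : Code :=
  (d.n, d.m,
    List.ofFn fun i => List.ofFn fun x => wordCode (d.u i x),
    List.ofFn fun i => List.ofFn fun j => wordCode (d.v i j),
    List.ofFn fun i => List.ofFn fun j => (d.r i j).val,
    List.ofFn fun x => genWordCode (d.img (Sum.inl x)),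
    List.ofFn fun i => genWordCode (d.img (Sum.inr i)))

end VFData

/-! If the kernels of the powers of `φ` agree from step `j` on, the straight part of a finite orbit
has at most `j` points: from `φ^a x = φ^(a+p) x` the element `x⁻¹ φ^p x` dies eventually, hence
already under `φ^j`, so `φ^j x` is periodic. It remains to bound such a `j` by the data.

On an invariant free subgroup `N` of finite rank, the images `φ^i(N)` are free of non-increasing
rank. When the rank does not drop at a step, the Hopf property makes `φ` injective on that image, so
the kernels on `N` are stable from then on. After that, the kernels in `G` can grow only through
their images in the finite quotient `G/N`. This gives `j ≤ rank N + [G : N]`.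

The given `F` need not be invariant; it is replaced by the intersection `N` of the kernels of all
homomorphisms `G → G/F`. As `G` has `n + m` generators, there are at most `m^(n+m)` of these, so `[G
: N]` and, by Schreier's bound, `rank N` are bounded by a primitive recursive function of `n` and
`m`. -/

/-! ### Finitely generated free groups: residual finiteness, rank, Hopf property -/

/-- A free group is residually finite: the partial action of the letters by left multiplication on
the set of the suffixes of a word extends to an action by permutations. -/
theorem FreeGroup.exists_hom_perm_ne_one {α : Type*} (g : FreeGroup α) (hg : g ≠ 1) :
    ∃ (S : Finset (FreeGroup α)) (f : FreeGroup α →* Equiv.Perm S), f g ≠ 1 := by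
  classical
  let S : Finset (FreeGroup α) := (g.toWord.tails.map FreeGroup.mk).toFinset
  have hS : ∀ L, L <:+ g.toWord → FreeGroup.mk L ∈ S := fun L hL => by
    simp only [S, List.mem_toFinset, List.mem_map, List.mem_tails]
    exact ⟨L, hL, rfl⟩
  let e : ∀ a : α, {s : S // FreeGroup.of a * s.1 ∈ S} ≃ {s : S // (FreeGroup.of a)⁻¹ * s.1 ∈ S} :=
    fun a =>
      { toFun := fun s => ⟨⟨FreeGroup.of a * s.1.1, s.2⟩, by simp⟩
        invFun := fun s => ⟨⟨(FreeGroup.of a)⁻¹ * s.1.1, s.2⟩, by simp⟩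
        left_inv := fun s => by simp
        right_inv := fun s => by simp }
  let σ : α → Equiv.Perm S := fun a => (e a).extendSubtype
  have hσ : ∀ a (s : S) (h : FreeGroup.of a * s.1 ∈ S), σ a s = ⟨FreeGroup.of a * s.1, h⟩ :=
    fun a s h => (e a).extendSubtype_apply_of_mem s h
  have h1 : (1 : FreeGroup α) ∈ S := hS [] (List.nil_suffix)
  have key : ∀ L (hL : L <:+ g.toWord),
      FreeGroup.lift σ (FreeGroup.mk L) ⟨1, h1⟩ = ⟨FreeGroup.mk L, hS L hL⟩ := by
    intro L
    induction L with
    | nil =>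
      intro hL
      change FreeGroup.lift σ 1 _ = _
      rw [_root_.map_one]; rfl
    | cons p L ih =>
      intro hL
      have hL' : L <:+ g.toWord := (List.suffix_cons p L).trans hL
      have ih := ih hL'
      obtain ⟨a, b⟩ := p
      cases b with
      | true =>
        have hmk : FreeGroup.mk ((a, true) :: L) = FreeGroup.of a * FreeGroup.mk L := rfl
        have hm := hS _ hL
        simp only [hmk] at hm ⊢
        rw [_root_.map_mul, Equiv.Perm.mul_apply, ih, FreeGroup.lift_apply_of, hσ a _ hm]
      | false =>
        have hmk : FreeGroup.mk ((a, false) :: L) = (FreeGroup.of a)⁻¹ * FreeGroup.mk L := rfl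
        have hm := hS _ hL
        simp only [hmk] at hm ⊢
        rw [_root_.map_mul, Equiv.Perm.mul_apply, ih, _root_.map_inv, FreeGroup.lift_apply_of,
          Equiv.Perm.inv_eq_iff_eq, hσ a _ (by simpa using hS L hL')]
        simp
  refine ⟨S, FreeGroup.lift σ, fun h => hg ?_⟩
  have : (FreeGroup.lift σ (FreeGroup.mk g.toWord) ⟨1, h1⟩ : FreeGroup α) =
      FreeGroup.mk g.toWord := congrArg Subtype.val (key g.toWord List.suffix_rfl)
  rw [FreeGroup.mk_toWord, h] at this
  exact this.symm

/-- The number of free generators of a finitely generated free group is its rank. -/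
theorem IsFreeGroup.finite_generators_and_card {A : Type*} [Group A] [IsFreeGroup A] [Group.FG A] :
    Finite (IsFreeGroup.Generators A) ∧
      Nat.card (IsFreeGroup.Generators A) = Group.rank A := by
  classical
  obtain ⟨S, hS, hcl⟩ := Group.rank_spec A
  -- A group of order 2: homomorphisms to it number 2 to the size of a basis, and are determined by
  -- their values on `S`.
  let P := Equiv.Perm (Fin 2)
  have hP : Nat.card P = 2 := by
    rw [Nat.card_perm, Nat.card_eq_fintype_card, Fintype.card_fin, Nat.factorial_two]
  let j : (IsFreeGroup.Generators A → P) → (S → P) := fun f s => IsFreeGroup.lift f s.1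
  have hj : Function.Injective j := fun f g h => by
    apply IsFreeGroup.lift.injective
    exact MonoidHom.eq_of_eqOn_dense hcl fun s hs => congrFun h ⟨s, hs⟩
  have hfin : Finite (IsFreeGroup.Generators A → P) := Finite.of_injective j hj
  have hX : Finite (IsFreeGroup.Generators A) := by
    by_contra hX
    rw [not_finite_iff_infinite] at hX
    exact not_finite (IsFreeGroup.Generators A → P)
  refine ⟨hX, le_antisymm ?_ ?_⟩
  · have := Nat.card_le_card_of_injective j hj
    rw [Nat.card_fun, Nat.card_fun, hP, Nat.card_eq_fintype_card (α := S), Fintype.card_coe,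
      hS] at this
    exact (Nat.pow_le_pow_iff_right (by norm_num)).1 this
  · have := Fintype.ofFinite (IsFreeGroup.Generators A)
    have h : Subgroup.closure
        ((Finset.univ.image (IsFreeGroup.of : IsFreeGroup.Generators A → A) : Finset A) : Set A)
          = ⊤ := by
      have h2 : FreeGroup.lift (IsFreeGroup.of : IsFreeGroup.Generators A → A) =
          (IsFreeGroup.mulEquiv A).toMonoidHom := by
        ext x
        simp [IsFreeGroup.of]
      rw [Finset.coe_image, Finset.coe_univ, Set.image_univ,
        ← FreeGroup.lift_surjective_iff_closure_range_eq_top, h2]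
      exact (IsFreeGroup.mulEquiv A).surjective
    refine (Group.rank_le h).trans (Finset.card_image_le.trans ?_)
    rw [Finset.card_univ, Nat.card_eq_fintype_card]

/-- The Hopf property: a surjective homomorphism of finitely generated free groups which does not
lower the rank is injective. -/
theorem IsFreeGroup.injective_of_surjective_of_rank_le {A B : Type*} [Group A] [Group B]
    [IsFreeGroup A] [IsFreeGroup B] [Group.FG A] [Group.FG B] (f : A →* B)
    (hf : Function.Surjective f) (h : Group.rank A ≤ Group.rank B) : Function.Injective f := by
  obtain ⟨hA, hA'⟩ := IsFreeGroup.finite_generators_and_card (A := A)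
  obtain ⟨hB, hB'⟩ := IsFreeGroup.finite_generators_and_card (A := B)
  rw [injective_iff_map_eq_one]
  intro a ha
  by_contra hne
  obtain ⟨S, ρ, hρ⟩ := FreeGroup.exists_hom_perm_ne_one (IsFreeGroup.toFreeGroup A a)
    (by simpa using hne)
  let P := Equiv.Perm S
  have hfinA : Finite (A →* P) := Finite.of_equiv _ (IsFreeGroup.lift (G := A) (H := P))
  have hcard : Nat.card (A →* P) ≤ Nat.card (B →* P) := by
    rw [← Nat.card_congr (IsFreeGroup.lift (G := A) (H := P)),
      ← Nat.card_congr (IsFreeGroup.lift (G := B) (H := P)), Nat.card_fun, Nat.card_fun, hA', hB']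
    exact Nat.pow_le_pow_right Nat.card_pos h
  -- Precomposition is injective between finite sets, hence bijective by the count: every
  -- homomorphism from `A` to `P` factors through `f`, even `ρ`, which does not kill `a`.
  let c : (B →* P) → (A →* P) := fun k => k.comp f
  have hc : Function.Injective c := fun k l hkl => (MonoidHom.cancel_right hf).1 hkl
  obtain ⟨k, hk⟩ := (hc.bijective_of_nat_card_le hcard).2
    (ρ.comp (IsFreeGroup.toFreeGroup A).toMonoidHom)
  apply hρ
  have := DFunLike.congr_fun hk a
  change k (f a) = ρ (IsFreeGroup.toFreeGroup A a) at this
  rw [← this, ha, map_one]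

/-! ### Stationary kernels and finite orbits -/

/-- An antitone sequence of natural numbers stops before `ρ 0 + 1`. -/
theorem Nat.exists_le_eq_succ_of_antitone (ρ : ℕ → ℕ) (h : ∀ i, ρ (i + 1) ≤ ρ i) :
    ∃ i ≤ ρ 0, ρ (i + 1) = ρ i := by
  by_contra! hne
  have : ∀ i ≤ ρ 0 + 1, ρ i + i ≤ ρ 0 := by
    intro i
    induction i with
    | zero => simp
    | succ i ih =>
      intro hi
      have := ih (by omega)
      have := h i
      have := hne i (by omega)
      omega
  have := this (ρ 0 + 1) le_rfl
  omega

/-- The kernels of the iterates of an endomorphism of a finitely generated free group are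
stationary from a step which is at most the rank. -/
theorem IsFreeGroup.exists_iterate_ker_stable {N : Type*} [Group N] [IsFreeGroup N] [Group.FG N]
    (ψ : Monoid.End N) :
    ∃ i ≤ Group.rank N, ∀ x, (ψ ^ (i + 1)) x = 1 → (ψ ^ i) x = 1 := by
  let R : ℕ → Subgroup N := fun i => MonoidHom.range (ψ ^ i)
  have hfg : ∀ i, Group.FG (R i) := fun i =>
    Group.fg_of_surjective (MonoidHom.rangeRestrict_surjective (ψ ^ i : N →* N))
  have hmem : ∀ i (x : R i), ψ x.1 ∈ R (i + 1) := by
    rintro i ⟨_, y, rfl⟩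
    exact ⟨y, by rw [pow_succ']; rfl⟩
  let q : ∀ i, R i →* R (i + 1) := fun i =>
    ((ψ : N →* N).comp (R i).subtype).codRestrict (R (i + 1)) (hmem i)
  have hq : ∀ i, Function.Surjective (q i) := by
    rintro i ⟨_, y, rfl⟩
    refine ⟨⟨(ψ ^ i) y, y, rfl⟩, Subtype.ext ?_⟩
    change ψ ((ψ ^ i) y) = (ψ ^ (i + 1)) y
    rw [pow_succ']; rfl
  obtain ⟨i, hi, he⟩ := Nat.exists_le_eq_succ_of_antitone (fun i => Group.rank (R i))
    fun i => Group.rank_le_of_surjective (q i) (hq i)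
  refine ⟨i, hi.trans ?_, fun x hx => ?_⟩
  · exact Group.rank_le_of_surjective _ (MonoidHom.rangeRestrict_surjective (ψ ^ 0 : N →* N))
  · have hinj := IsFreeGroup.injective_of_surjective_of_rank_le (q i) (hq i) he.ge
    have h1 : q i ⟨(ψ ^ i) x, x, rfl⟩ = 1 := by
      apply Subtype.ext
      rw [pow_succ'] at hx
      exact hx
    exact congrArg Subtype.val ((injective_iff_map_eq_one _).1 hinj _ h1)

/-- If the kernels of the iterates of `φ` on an invariant subgroup are stationary at the step `i`, then
also at every later step. -/
theorem MonoidHom.iterate_succ_eq_one_of_le {G : Type*} [Group G] (φ : Monoid.End G)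
    (N : Subgroup G) (hN : ∀ x ∈ N, φ x ∈ N) {i j : ℕ} (hij : i ≤ j)
    (h : ∀ x ∈ N, (φ ^ (i + 1)) x = 1 → (φ ^ i) x = 1) :
    ∀ x ∈ N, (φ ^ (j + 1)) x = 1 → (φ ^ j) x = 1 := by
  induction j, hij using Nat.le_induction with
  | base => exact h
  | succ j _ ih =>
    intro x hx h1
    rw [pow_succ] at h1 ⊢
    exact ih (φ x) (hN x hx) h1

/-- The kernels of the iterates of an endomorphism which preserves a free normal subgroup `N` of
finite index are stationary from a step which is at most the rank plus the index of `N`. -/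
theorem Subgroup.exists_iterate_ker_stable {G : Type*} [Group G] (φ : Monoid.End G)
    (N : Subgroup G) [N.Normal] [N.FiniteIndex] [IsFreeGroup N] [Group.FG N]
    (hN : ∀ x ∈ N, φ x ∈ N) :
    ∃ j ≤ Group.rank N + N.index, ∀ x, (φ ^ (j + 1)) x = 1 → (φ ^ j) x = 1 := by
  let ψ : Monoid.End N := ((φ : G →* G).comp N.subtype).codRestrict N fun x => hN x x.2
  have hψ : ∀ i (x : N), ((ψ ^ i) x : G) = (φ ^ i) x := by
    intro i
    induction i with
    | zero => intro x; rfl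
    | succ i ih =>
      intro x
      rw [pow_succ, pow_succ]
      exact ih (ψ x)
  obtain ⟨i, hi, hst⟩ := IsFreeGroup.exists_iterate_ker_stable ψ
  have hst' : ∀ x ∈ N, (φ ^ (i + 1)) x = 1 → (φ ^ i) x = 1 := fun x hx h1 => by
    have h := hst ⟨x, hx⟩ (Subtype.ext (by rw [hψ]; exact h1))
    rw [← hψ i ⟨x, hx⟩, h]; rfl
  let T : ℕ → Subgroup (G ⧸ N) := fun j => (MonoidHom.ker (φ ^ j : Monoid.End G)).map (QuotientGroup.mk' N)
  have hT : ∀ j, T j ≤ T (j + 1) := fun j => Subgroup.map_mono fun x hx => by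
    have hx' : (φ ^ j) x = 1 := hx
    change (φ ^ (j + 1)) x = 1
    rw [pow_succ']
    change φ ((φ ^ j) x) = 1
    rw [hx', map_one]
  have hcard : ∀ j, Nat.card (T j) ≤ N.index := fun j => Subgroup.card_le_card_group (T j)
  have hTc : ∀ j, Nat.card (T j) ≤ Nat.card (T (j + 1)) := fun j =>
    Subgroup.card_le_of_le (hT j)
  -- The search starts at `i`, where the kernels on `N` are already stable; the codimension-like
  -- difference turns growth of `T` into descent.
  obtain ⟨k, hk, he⟩ := Nat.exists_le_eq_succ_of_antitone
    (fun k => N.index - Nat.card (T (i + k))) fun k => Nat.sub_le_sub_left (hTc (i + k)) _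
  refine ⟨i + k, add_le_add hi (hk.trans (Nat.sub_le _ _)), fun x hx => ?_⟩
  have hle : Nat.card (T (i + k + 1)) ≤ Nat.card (T (i + k)) := by
    have h1 := hcard (i + k)
    have h2 := hcard (i + k + 1)
    have he' : N.index - Nat.card (T (i + k + 1)) = N.index - Nat.card (T (i + k)) := he
    omega
  have hTeq : T (i + k) = T (i + k + 1) := Subgroup.eq_of_le_of_card_ge (hT _) hle
  have hxT : (QuotientGroup.mk' N x) ∈ T (i + k) := by
    rw [hTeq]
    exact ⟨x, hx, rfl⟩
  -- Correcting `x` by an element `y` of the smaller kernel in the same coset moves the question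
  -- into `N`.
  obtain ⟨y, hy, hyx⟩ := hxT
  have hyN : y⁻¹ * x ∈ N := QuotientGroup.eq.1 hyx
  have hy1 : (φ ^ (i + k)) y = 1 := hy
  have h1 : (φ ^ (i + k + 1)) (y⁻¹ * x) = 1 := by
    rw [map_mul, hx, map_inv, pow_succ']
    change (φ ((φ ^ (i + k)) y))⁻¹ * 1 = 1
    simp [hy1]
  have h2 := MonoidHom.iterate_succ_eq_one_of_le φ N hN (Nat.le_add_right i k) hst' _ hyN h1
  rwa [map_mul, map_inv, hy1, inv_one, one_mul] at h2

/-- If the kernels of the iterates of `φ` are stationary from the step `j` on, then the straight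
part of a finite orbit is contained in the first `j` points. -/
theorem ncard_straightPart_le {G : Type*} [Group G] (φ : Monoid.End G) (j : ℕ)
    (hj : ∀ x, (φ ^ (j + 1)) x = 1 → (φ ^ j) x = 1) (x : G) (hx : (endOrbit φ x).Finite) :
    (straightPart φ x).ncard ≤ j := by
  have hpow : ∀ (i : ℕ) (y : G), (φ ^ i) y = φ^[i] y := fun i y => by
    rw [Monoid.End.coe_pow]
  have hst : ∀ i ≥ j, ∀ y, (φ ^ i) y = 1 → (φ ^ j) y = 1 := by
    intro i hi
    induction i, hi using Nat.le_induction with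
    | base => exact fun y => id
    | succ i hi ih =>
      intro y hy
      exact ih y (MonoidHom.iterate_succ_eq_one_of_le φ ⊤ (fun _ _ => trivial) hi
        (fun y _ => hj y) y trivial hy)
  have hninj : ¬ Function.Injective fun k : ℕ => φ^[k] x := fun hinj =>
    Set.infinite_range_of_injective hinj hx
  have : ∃ a b, a < b ∧ φ^[a] x = φ^[b] x := by
    simp only [Function.Injective, not_forall] at hninj
    obtain ⟨a, b, hab, hne⟩ := hninj
    rcases lt_or_gt_of_ne hne with h | h
    · exact ⟨a, b, h, hab⟩
    · exact ⟨b, a, h, hab.symm⟩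
  obtain ⟨a, b, hab, he⟩ := this
  obtain ⟨p, hp, rfl⟩ : ∃ p, 0 < p ∧ b = a + p := ⟨b - a, by omega, by omega⟩
  have hper : φ^[j] x = φ^[j] (φ^[p] x) := by
    -- The exponent `a` would suffice for triviality; adding `j` makes it at least `j`, as `hst`
    -- requires.
    have h1 : (φ ^ (a + j)) (x⁻¹ * φ^[p] x) = 1 := by
      rw [map_mul, map_inv, hpow, hpow, add_comm a j, Function.iterate_add_apply,
        Function.iterate_add_apply, ← Function.iterate_add_apply φ a p, ← he, inv_mul_cancel]
    have h2 := hst _ (Nat.le_add_left j a) _ h1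
    rw [map_mul, map_inv, hpow, hpow, inv_mul_eq_one] at h2
    exact h2
  have hsub : straightPart φ x ⊆ (fun k : ℕ => φ^[k] x) '' (Finset.range j : Set ℕ) := by
    rintro _ ⟨⟨k, rfl⟩, hk⟩
    refine ⟨k, ?_, rfl⟩
    rw [Finset.coe_range, Set.mem_Iio]
    by_contra! hjk
    apply hk
    refine ⟨p, hp, ?_⟩
    obtain ⟨l, rfl⟩ := Nat.exists_eq_add_of_le' hjk
    change φ^[p] (φ^[l + j] x) = φ^[l + j] x
    rw [← Function.iterate_add_apply, add_comm p, Function.iterate_add_apply,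
      Function.iterate_add_apply φ l j, ← hper, ← Function.iterate_add_apply]
  refine (Set.ncard_le_ncard hsub (Set.toFinite _)).trans ?_
  refine (Set.ncard_image_le (Set.toFinite _)).trans ?_
  rw [Set.ncard_coe_finset, Finset.card_range]

/-! ### Fully invariant subgroup and computable bound -/

/-- A normal subgroup `F` of finite index in a finitely generated group contains a subgroup of
finite index which is preserved by all endomorphisms; its index is bounded. -/
theorem Subgroup.exists_fullyInvariant_le {G : Type*} [Group G] [Group.FG G] (F : Subgroup G)
    [F.Normal] [F.FiniteIndex] :
    ∃ N ≤ F, N.Normal ∧ (∀ φ : G →* G, ∀ x ∈ N, φ x ∈ N) ∧ N.index ≠ 0 ∧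
      N.index ≤ F.index ^ F.index ^ Group.rank G := by
  let P := G ⧸ F
  obtain ⟨S, hS, hcl⟩ := Group.rank_spec G
  let c : (G →* P) → (S → P) := fun f s => f s
  have hc : Function.Injective c := fun f g h =>
    MonoidHom.eq_of_eqOn_dense hcl fun s hs => congrFun h ⟨s, hs⟩
  have hfin : Finite (G →* P) := Finite.of_injective c hc
  have hP : Nat.card P = F.index := rfl
  have hcard : Nat.card (G →* P) ≤ F.index ^ Group.rank G := by
    have h := Nat.card_le_card_of_injective c hc
    rwa [Nat.card_fun, Nat.card_eq_fintype_card (α := S), Fintype.card_coe, hS, hP] at h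
  let D : G →* ((G →* P) → P) := MonoidHom.pi fun f => f
  have hD : ∀ x, x ∈ D.ker ↔ ∀ f : G →* P, f x = 1 := fun x => by
    rw [MonoidHom.mem_ker, funext_iff]; rfl
  have hidx : D.ker.index = Nat.card D.range := Subgroup.index_ker D
  refine ⟨D.ker, fun x hx => ?_, inferInstance, fun φ x hx => ?_, ?_, ?_⟩
  · exact (QuotientGroup.eq_one_iff x).1 ((hD x).1 hx (QuotientGroup.mk' F))
  -- Full invariance: `f.comp φ` is again one of the homomorphisms whose kernels are intersected.
  · exact (hD _).2 fun f => (hD x).1 hx (f.comp φ)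
  · rw [hidx]
    exact Nat.card_pos.ne'
  · rw [hidx]
    refine (Subgroup.card_le_card_group D.range).trans ?_
    rw [Nat.card_fun, hP]
    exact Nat.pow_le_pow_right (Nat.pos_of_ne_zero Subgroup.FiniteIndex.index_ne_zero) hcard

/-- The bound for the size of the straight parts in terms of the rank `n` of the free normal
subgroup and its index `m`. -/
def straightBound (n m : ℕ) : ℕ :=
  m ^ m ^ (n + m) * (n + m) + m ^ m ^ (n + m)

theorem Primrec₂.nat_pow : Primrec₂ ((· ^ ·) : ℕ → ℕ → ℕ) := by
  have h : Primrec₂ fun a b : ℕ => Nat.rec (motive := fun _ => ℕ) 1 (fun _ r => r * a) b :=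
    Primrec.nat_rec (Primrec.const 1)
      (Primrec.nat_mul.comp (Primrec.snd.comp Primrec.snd) Primrec.fst).to₂
  refine h.of_eq fun a b => ?_
  induction b with
  | zero => rfl
  | succ b ih => rw [pow_succ, ← ih]

theorem primrec_straightBound : Primrec₂ straightBound := by
  have hs : Primrec fun p : ℕ × ℕ => p.1 + p.2 := Primrec.nat_add.comp Primrec.fst Primrec.snd
  have hM : Primrec fun p : ℕ × ℕ => p.2 ^ p.2 ^ (p.1 + p.2) :=
    Primrec₂.nat_pow.comp Primrec.snd (Primrec₂.nat_pow.comp Primrec.snd hs)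
  exact Primrec.nat_add.comp (Primrec.nat_mul.comp hM hs) hM

theorem VFData.Describes.ncard_straightPart_le {G : Type*} [Group G] {φ : G →* G} {d : VFData}
    (h : d.Describes φ) (x : G) (hx : (endOrbit φ x).Finite) :
    (straightPart φ x).ncard ≤ straightBound d.n d.m := by
  classical
  obtain ⟨gen, h⟩ := h
  let F := d.freePart gen
  have := h.normal
  have hcl : Subgroup.closure ((Finset.univ.image gen : Finset G) : Set G) = ⊤ := by
    rw [Finset.coe_image, Finset.coe_univ, Set.image_univ,
      ← FreeGroup.lift_surjective_iff_closure_range_eq_top]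
    exact h.surjective
  have hFG : Group.FG G := Group.fg_iff.2 ⟨_, hcl, Finset.finite_toSet _⟩
  have hrank : Group.rank G ≤ d.n + d.m := by
    refine (Group.rank_le hcl).trans (Finset.card_image_le.trans ?_)
    simp
  have hsurj : Function.Surjective fun i : Fin d.m => (gen (Sum.inr i) : G ⧸ F) := by
    intro g
    obtain ⟨g, rfl⟩ := QuotientGroup.mk_surjective g
    obtain ⟨i, ⟨f, hf, rfl⟩, -⟩ := h.cosets g
    refine ⟨i, ?_⟩
    change (gen (Sum.inr i) : G ⧸ F) = ((f : G) : G ⧸ F) * (gen (Sum.inr i) : G ⧸ F)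
    rw [(QuotientGroup.eq_one_iff f).2 hf, one_mul]
  have hfinQ : Finite (G ⧸ F) := Finite.of_surjective _ hsurj
  have hFidx : F.index ≤ d.m := by
    have := Nat.card_le_card_of_surjective _ hsurj
    rwa [Nat.card_fin] at this
  have hFfin : F.FiniteIndex := Subgroup.finiteIndex_of_finite_quotient
  have hm : 0 < d.m := (Nat.pos_of_ne_zero hFfin.index_ne_zero).trans_le hFidx
  have hFfree : IsFreeGroup F := IsFreeGroup.ofMulEquiv (MonoidHom.ofInjective h.free)
  obtain ⟨N, hNF, hNn, hNφ, hN0, hNi⟩ := Subgroup.exists_fullyInvariant_le F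
  have hNfin : N.FiniteIndex := ⟨hN0⟩
  have hNfree : IsFreeGroup N := IsFreeGroup.ofMulEquiv (Subgroup.subgroupOfEquivOfLe hNF)
  have hNfg : Group.FG N := inferInstance
  have hNi' : N.index ≤ d.m ^ d.m ^ (d.n + d.m) := by
    refine hNi.trans ((Nat.pow_le_pow_left hFidx _).trans (Nat.pow_le_pow_right hm ?_))
    exact (Nat.pow_le_pow_left hFidx _).trans (Nat.pow_le_pow_right hm hrank)
  obtain ⟨j, hj, hst⟩ := N.exists_iterate_ker_stable (φ : Monoid.End G) (hNφ φ)
  refine (_root_.ncard_straightPart_le (φ : Monoid.End G) j hst x hx).trans (hj.trans ?_)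
  exact add_le_add ((Subgroup.rank_le_index_mul_rank N).trans (Nat.mul_le_mul hNi' hrank)) hNi'

/-! ### Existence of data -/

namespace VFData

variable {G : Type*} [Group G]

/-- If the relations of the data hold in `G`, the letters `a_x` are free and `G` is the disjoint
union of the cosets `F b_i`, then the relations are defining relations. -/
theorem ker_lift_eq_normalClosure_rels (d : VFData) (gen : Fin d.n ⊕ Fin d.m → G)
    (free : Function.Injective (FreeGroup.lift fun x => gen (Sum.inl x)))
    (cosets : ∀ g : G, ∃! i : Fin d.m, ∃ f ∈ d.freePart gen, g = f * gen (Sum.inr i))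
    (hu : ∀ i x, gen (Sum.inr i) * gen (Sum.inl x) =
      FreeGroup.lift (fun x => gen (Sum.inl x)) (FreeGroup.mk (d.u i x)) * gen (Sum.inr i))
    (hv : ∀ i j, gen (Sum.inr i) * gen (Sum.inr j) =
      FreeGroup.lift (fun x => gen (Sum.inl x)) (FreeGroup.mk (d.v i j)) *
        gen (Sum.inr (d.r i j))) :
    (FreeGroup.lift gen).ker = Subgroup.normalClosure d.rels := by
  let R := Subgroup.normalClosure d.rels
  let π := QuotientGroup.mk' R
  let A : FreeGroup (Fin d.n) →* FreeGroup (Fin d.n ⊕ Fin d.m) := FreeGroup.map Sum.inl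
  let α : FreeGroup (Fin d.n) →* FreeGroup (Fin d.n ⊕ Fin d.m) ⧸ R := π.comp A
  let β : Fin d.m → FreeGroup (Fin d.n ⊕ Fin d.m) ⧸ R := fun i => π (FreeGroup.of (Sum.inr i))
  let a : FreeGroup (Fin d.n) →* G := FreeGroup.lift fun x => gen (Sum.inl x)
  have hA : ∀ f, FreeGroup.lift gen (A f) = a f := by
    intro f
    have : (FreeGroup.lift gen).comp A = a := by
      ext x
      simp [A, a]
    exact DFunLike.congr_fun this f
  have hRker : R ≤ (FreeGroup.lift gen).ker := by
    refine Subgroup.normalClosure_le_normal ?_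
    rintro _ (⟨⟨i, x⟩, rfl⟩ | ⟨⟨i, j⟩, rfl⟩)
    · change FreeGroup.lift gen _ = 1
      rw [map_mul, map_mul, map_inv, map_mul, mul_inv_eq_one]
      simp only [FreeGroup.lift_apply_of]
      exact (hu i x).trans (congrArg (· * gen (Sum.inr i)) (hA _).symm)
    · change FreeGroup.lift gen _ = 1
      rw [map_mul, map_mul, map_inv, map_mul, mul_inv_eq_one]
      simp only [FreeGroup.lift_apply_of]
      exact (hv i j).trans (congrArg (· * gen (Sum.inr (d.r i j))) (hA _).symm)
  have hπ : ∀ w ∈ d.rels, π w = 1 := fun w hw =>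
    (QuotientGroup.eq_one_iff w).2 (Subgroup.subset_normalClosure hw)
  have hβα : ∀ i x, β i * α (FreeGroup.of x) = α (FreeGroup.mk (d.u i x)) * β i := by
    intro i x
    have := hπ _ (Or.inl ⟨(i, x), rfl⟩)
    rw [map_mul, map_mul, map_inv, map_mul, mul_inv_eq_one] at this
    refine Eq.trans ?_ this
    change β i * π (FreeGroup.map Sum.inl (FreeGroup.of x)) = _
    rw [FreeGroup.map.of]
  have hββ : ∀ i j, β i * β j = α (FreeGroup.mk (d.v i j)) * β (d.r i j) := by
    intro i j
    have := hπ _ (Or.inr ⟨(i, j), rfl⟩)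
    rwa [map_mul, map_mul, map_inv, map_mul, mul_inv_eq_one] at this
  have hβα' : ∀ i f, ∃ f', β i * α f = α f' * β i := by
    intro i f
    induction f using FreeGroup.induction_on with
    | C1 => exact ⟨1, by simp⟩
    | of x => exact ⟨_, hβα i x⟩
    | inv_of x ih =>
      obtain ⟨f', h⟩ := ih
      refine ⟨f'⁻¹, ?_⟩
      rw [map_inv, map_inv, mul_inv_eq_iff_eq_mul, mul_assoc, eq_inv_mul_iff_mul_eq]
      exact h.symm
    | mul x y hx hy =>
      obtain ⟨x', hx⟩ := hx
      obtain ⟨y', hy⟩ := hy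
      exact ⟨x' * y', by rw [map_mul, map_mul, ← mul_assoc, hx, mul_assoc, hy, mul_assoc]⟩
  have huniq : ∀ {i j : Fin d.m} {f f' : G}, f ∈ d.freePart gen → f' ∈ d.freePart gen →
      f * gen (Sum.inr i) = f' * gen (Sum.inr j) → i = j := fun hf hf' h =>
    (cosets _).unique ⟨_, hf, rfl⟩ ⟨_, hf', h⟩
  -- `e` is the index of the coset `F` itself; its representative `b_e` need not be 1.
  obtain ⟨e, ⟨f₀, hf₀, he₀⟩, -⟩ := cosets 1
  have heF : gen (Sum.inr e) ∈ d.freePart gen := by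
    rw [← inv_eq_of_mul_eq_one_right he₀.symm]
    exact inv_mem hf₀
  have hre : ∀ i j, gen (Sum.inr i) * gen (Sum.inr j) ∈ d.freePart gen → d.r i j = e := by
    intro i j h
    refine huniq ⟨_, rfl⟩ (mul_mem h hf₀) ((hv i j).symm.trans ?_)
    rw [mul_assoc, ← he₀, mul_one]
  -- The relation `b_e b_e = v_{e,e} b_e` lets `b_e` be cancelled, so it equals a word in the `a_x`
  -- in the presented group too.
  obtain ⟨w, hw⟩ : ∃ w, β e = α w := by
    refine ⟨FreeGroup.mk (d.v e e), mul_right_cancel (b := β e) ?_⟩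
    rw [hββ e e, hre e e (mul_mem heF heF)]
  have hone : ∀ f, α f = α (f * w⁻¹) * β e := fun f => by simp [hw]
  have normalForm : ∀ g, ∃ f i, π g = α f * β i := by
    intro g
    induction g using FreeGroup.induction_on with
    | C1 => exact ⟨_, e, (map_one π).trans ((map_one α).symm.trans (hone 1))⟩
    | of s =>
      rcases s with x | i
      · refine ⟨_, e, Eq.trans ?_ (hone (FreeGroup.of x))⟩
        change _ = π (FreeGroup.map Sum.inl (FreeGroup.of x))
        rw [FreeGroup.map.of]
      · exact ⟨1, i, by rw [map_one, one_mul]⟩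
    | inv_of s _ =>
      rcases s with x | i
      · refine ⟨_, e, Eq.trans ?_ (hone (FreeGroup.of x)⁻¹)⟩
        change _ = π (FreeGroup.map Sum.inl (FreeGroup.of x)⁻¹)
        rw [map_inv (FreeGroup.map Sum.inl), FreeGroup.map.of]
      · obtain ⟨j, ⟨f, hf, hj⟩, -⟩ := cosets (gen (Sum.inr i))⁻¹
        have hji : gen (Sum.inr j) * gen (Sum.inr i) ∈ d.freePart gen := by
          rw [eq_comm, ← eq_inv_mul_iff_mul_eq] at hj
          rw [hj, inv_mul_cancel_right]
          exact inv_mem hf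
        refine ⟨(FreeGroup.mk (d.v j i) * w)⁻¹, j, ?_⟩
        have h := hββ j i
        rw [hre j i hji, hw, ← map_mul α] at h
        rw [map_inv, map_inv, eq_inv_mul_iff_mul_eq, ← h]
        exact mul_inv_cancel_right _ _
    | mul x y hx hy =>
      obtain ⟨f, i, hx⟩ := hx
      obtain ⟨f', j, hy⟩ := hy
      obtain ⟨f'', h⟩ := hβα' i f'
      refine ⟨f * f'' * FreeGroup.mk (d.v i j), d.r i j, ?_⟩
      rw [map_mul, hx, hy, map_mul, map_mul, mul_assoc (α f * α f''), ← hββ, mul_assoc (α f),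
        ← mul_assoc (β i), h]
      simp only [mul_assoc]
  -- A kernel element has a normal form `f b_i`; its triviality in `G` forces `i = e`, and then
  -- freeness gives `f w = 1`.
  refine le_antisymm (fun g hg => ?_) hRker
  obtain ⟨f, i, h⟩ := normalForm g
  have hgf : ∀ y, π g = π y → FreeGroup.lift gen y = 1 := fun y hy => by
    have h1 : FreeGroup.lift gen (g⁻¹ * y) = 1 := hRker (QuotientGroup.eq.1 hy)
    rwa [map_mul, map_inv, MonoidHom.mem_ker.1 hg, inv_one, one_mul] at h1
  have hfi := hgf (A f * FreeGroup.of (Sum.inr i)) (h.trans (map_mul π _ _).symm)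
  rw [map_mul, hA, FreeGroup.lift_apply_of] at hfi
  have hie : i = e := huniq ⟨f, rfl⟩ hf₀ (hfi.trans he₀)
  rw [hie, hw, ← map_mul] at h
  have hfw : a (f * w) = 1 := (hA _).symm.trans (hgf (A (f * w)) h)
  have hfw' : f * w = 1 := free (hfw.trans (map_one _).symm)
  rw [hfw', map_one] at h
  exact (QuotientGroup.eq_one_iff g).1 h

/-- A group with a finitely generated free normal subgroup of finite index, with an endomorphism,
is described by data. -/
theorem exists_describes (F : Subgroup G) [F.Normal] [F.FiniteIndex] [IsFreeGroup F]
    [Group.FG F] (φ : G →* G) : ∃ d : VFData, d.Describes φ := by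
  obtain ⟨hfin, -⟩ := IsFreeGroup.finite_generators_and_card (A := F)
  obtain ⟨n, ⟨e⟩⟩ := Finite.exists_equiv_fin (IsFreeGroup.Generators F)
  obtain ⟨m, ⟨q⟩⟩ := Finite.exists_equiv_fin (G ⧸ F)
  let c : FreeGroup (Fin n) ≃* F :=
    (FreeGroup.freeGroupCongr e.symm).trans (IsFreeGroup.mulEquiv F)
  let gen : Fin n ⊕ Fin m → G :=
    Sum.elim (fun x => c (FreeGroup.of x)) fun i => (q.symm i).out
  have hc : ∀ f, FreeGroup.lift (fun x => gen (Sum.inl x)) f = c f := by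
    intro f
    have : FreeGroup.lift (fun x => gen (Sum.inl x)) = F.subtype.comp c.toMonoidHom := by
      ext x
      simp [gen]
    exact DFunLike.congr_fun this f
  have hrange : (FreeGroup.lift fun x => gen (Sum.inl x)).range = F := by
    ext g
    constructor
    · rintro ⟨f, rfl⟩
      rw [hc]
      exact (c f).2
    · intro hg
      obtain ⟨f, hf⟩ := c.surjective ⟨g, hg⟩
      exact ⟨f, by rw [hc, hf]⟩
  have hword : ∀ g ∈ F, ∃ L : List (Fin n × Bool),
      FreeGroup.lift (fun x => gen (Sum.inl x)) (FreeGroup.mk L) = g := by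
    intro g hg
    rw [← hrange] at hg
    obtain ⟨f, hf⟩ := hg
    exact ⟨f.toWord, by rw [FreeGroup.mk_toWord]; exact hf⟩
  have hq : ∀ i, (gen (Sum.inr i) : G ⧸ F) = q.symm i := fun i => Quotient.out_eq _
  have hcoset : ∀ g : G, g * (gen (Sum.inr (q g)))⁻¹ ∈ F := by
    intro g
    rw [← QuotientGroup.eq_one_iff, QuotientGroup.mk_mul, QuotientGroup.mk_inv, hq,
      Equiv.symm_apply_apply, mul_inv_cancel]
  have hsurj : Function.Surjective (FreeGroup.lift gen) := by
    intro g
    obtain ⟨L, hL⟩ := hword _ (hcoset g)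
    refine ⟨FreeGroup.map Sum.inl (FreeGroup.mk L) * FreeGroup.of (Sum.inr (q g)), ?_⟩
    have h : FreeGroup.lift gen (FreeGroup.map Sum.inl (FreeGroup.mk L)) =
        FreeGroup.lift (fun x => gen (Sum.inl x)) (FreeGroup.mk L) := by
      have : (FreeGroup.lift gen).comp (FreeGroup.map Sum.inl) =
          FreeGroup.lift (fun x => gen (Sum.inl x)) := by
        ext x
        simp
      exact DFunLike.congr_fun this (FreeGroup.mk L)
    rw [map_mul, h, hL, FreeGroup.lift_apply_of, inv_mul_cancel_right]
  choose u hu using fun (i : Fin m) (x : Fin n) =>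
    hword (gen (Sum.inr i) * gen (Sum.inl x) * (gen (Sum.inr i))⁻¹)
      (Subgroup.Normal.conj_mem ‹_› _ (c (FreeGroup.of x)).2 _)
  choose v hv using fun i j : Fin m => hword _ (hcoset (gen (Sum.inr i) * gen (Sum.inr j)))
  choose img himg using fun s => hsurj (φ (gen s))
  let d : VFData :=
    { n := n
      m := m
      u := u
      v := v
      r := fun i j => q (gen (Sum.inr i) * gen (Sum.inr j) : G)
      img := fun s => (img s).toWord }
  have hF : d.freePart gen = F := hrange
  have hfree : Function.Injective (FreeGroup.lift fun x => gen (Sum.inl x)) := by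
    intro f g h
    rw [hc, hc] at h
    exact c.injective (Subtype.ext h)
  have hcosets : ∀ g : G, ∃! i : Fin m, ∃ f ∈ d.freePart gen, g = f * gen (Sum.inr i) := by
    intro g
    rw [hF]
    refine ⟨q g, ⟨_, hcoset g, (inv_mul_cancel_right _ _).symm⟩, ?_⟩
    rintro i ⟨f, hf, rfl⟩
    rw [QuotientGroup.mk_mul, (QuotientGroup.eq_one_iff f).2 hf, one_mul, hq,
      Equiv.apply_symm_apply]
  refine ⟨d, gen, hsurj, ?_, hfree, ?_, hcosets, ?_⟩
  · refine d.ker_lift_eq_normalClosure_rels gen hfree hcosets (fun i x => ?_) fun i j => ?_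
    · exact eq_mul_of_mul_inv_eq (hu i x).symm
    · exact eq_mul_of_mul_inv_eq (hv i j).symm
  · rw [hF]
    infer_instance
  · intro s
    change _ = FreeGroup.lift gen (FreeGroup.mk (img s).toWord)
    rw [FreeGroup.mk_toWord, himg]

end VFData

theorem proposition5p5 :
    ∃ K : VFData.Code → ℕ, Computable K ∧
      ∀ (G : Type*) [Group G], Group.FG G → IsVirtuallyFree G → ∀ φ : G →* G,
        (∃ d : VFData, d.Describes φ) ∧
        ∀ d : VFData, d.Describes φ →
          ∀ x : G, (endOrbit φ x).Finite → (straightPart φ x).ncard ≤ K d.code := by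
  refine ⟨fun c => straightBound c.1 c.2.1, ?_, ?_⟩
  · exact (primrec_straightBound.comp Primrec.fst (Primrec.fst.comp Primrec.snd)).to_comp
  · rintro G _ hFG ⟨H, hH, hfree⟩ φ
    refine ⟨?_, fun d hd x hx => hd.ncard_straightPart_le x hx⟩
    -- The normal core is still of finite index; it is free by Nielsen–Schreier and finitely
    -- generated by Schreier's lemma.
    have : IsFreeGroup H.normalCore :=
      IsFreeGroup.ofMulEquiv (Subgroup.subgroupOfEquivOfLe H.normalCore_le)
    have : Group.FG H.normalCore := inferInstance
    exact VFData.exists_describes H.normalCore φ
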